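/- Let $\operatorname{cn}(\cdot\,|\,m)$, $m\in(0,1)$, be the Jacobi cosine, defined by $\operatorname{cn}(\sigma(\varphi,m)\,|\,m)=\cos\varphi$ with $\sigma(\varphi,m)=\int_0^\varphi \frac{d\theta}{\sqrt{1-m\sin^2\theta}}$. Let $\bar T=4\,\sigma(\pi/2,1/2)\simeq 7.416$ be the period of $\operatorname{cn}(\cdot\,|\,\tfrac12)$, and let $$k(s)=\sqrt2\,\operatorname{cn}\!\big(s+\bar T/4\,\big|\,\tfrac12\big),\qquad s\in\mathbb R,$$ which is the curvature (as a function of arc length) of the planar Willmore curve, so that $k''=-\tfrac12k^3$. For $\phi:\mathbb R\to\mathbb R$ put $$\tilde L_0\phi=\phi^{(4)}+\Big(\tfrac52k^2\phi'\Big)'+\Big(3(k')^2-\tfrac12k^4\Big)\phi .$$ For $0<\alpha<1$ let $C^{4,\alpha}_{\bar T}(\mathbb R)$ be the space of four times differentiable functions $\phi:\mathbb R\to\mathbb R$ whose fourth derivative is Hölder continuous of exponent $\alpha$ and which satisfy $\phi(s)=-\phi(-s)=-\phi(s+\bar T/2)$ for all $s\in\mathbb R$. **Proposition 2.2.** Let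 $\bar g=\tfrac98k^5-9k(k')^2$ and $0<\alpha<1$. Then the equation $\tilde L_0\bar\phi=\bar g$ on $\mathbb R$ has exactly one solution $\bar\phi$ in $C^{4,\alpha}_{\bar T}(\mathbb R)$. This solution is of class $C^\infty$, and for every $s\in\mathbb R$ it is given by the convergent series $$\bar\phi(s)=\frac{3\pi\sqrt2}{64\,\Gamma(\frac34)^2}\sum_{m=0}^\infty\left(-\frac{\Gamma(m+\frac34)}{2\cdot4^m\,\Gamma(m+\frac94)}\,k(s)^{4m+5}+\frac{\Gamma(m+\frac14)}{4^m\,\Gamma(m+\frac74)}\,k(s)^{4m+3}\right).$$ Moreover, (i) $\bar\phi(s)\,k(s)\ge0$ for all $s\in\mathbb R$; (ii) $\bar\phi'(s)=0$ whenever $k(s)=0$. -/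

import Mathlib

open scoped NNReal ContDiff

namespace WillmoreCurve

noncomputable section

/-- The incomplete elliptic integral `σ(φ, m) = ∫₀^φ dθ / √(1 - m sin² θ)`. -/
def ellipticF (φ m : ℝ) : ℝ :=
  ∫ θ in (0 : ℝ)..φ, 1 / Real.sqrt (1 - m * Real.sin θ ^ 2)

/-- The Jacobi amplitude: the inverse function of `φ ↦ σ(φ, m)`, which for `0 < m < 1` is a
bijection of `ℝ` (see `ellipticF_bijective`). -/
def jacobiAm (u m : ℝ) : ℝ :=
  Function.invFun (fun φ : ℝ => ellipticF φ m) u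

/-- The Jacobi cosine, given implicitly by `cn(σ(φ, m) | m) = cos φ` (see `jacobiCn_ellipticF`). -/
def jacobiCn (u m : ℝ) : ℝ :=
  Real.cos (jacobiAm u m)

/-- The period `T̄ = 4 σ(π/2, 1/2) ≃ 7.416` of `cn(· | 1/2)`. -/
def period : ℝ :=
  4 * ellipticF (Real.pi / 2) (1 / 2)

/-- The curvature `k(s) = √2 cn(s + T̄/4 | 1/2)` of the planar Willmore curve. -/
def curvature (s : ℝ) : ℝ :=
  Real.sqrt 2 * jacobiCn (s + period / 4) (1 / 2)

/-- The linearized Willmore operator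
`L̃₀ φ = φ⁗ + ((5/2) k² φ')' + (3 (k')² - (1/2) k⁴) φ`. -/
def linWillmore (φ : ℝ → ℝ) (s : ℝ) : ℝ :=
  iteratedDeriv 4 φ s
    + deriv (fun t : ℝ => 5 / 2 * curvature t ^ 2 * deriv φ t) s
    + (3 * deriv curvature s ^ 2 - 1 / 2 * curvature s ^ 4) * φ s

/-- The right-hand side `ḡ = (9/8) k⁵ - 9 k (k')²`. -/
def gBar (s : ℝ) : ℝ :=
  9 / 8 * curvature s ^ 5 - 9 * curvature s * deriv curvature s ^ 2

/-- `C^{n,α}(ℝ)`: the functions that are `n` times differentiable with an `n`-th derivative that is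
Hölder continuous of exponent `α`. -/
def holderSpace (n : ℕ) (α : ℝ≥0) : Set (ℝ → ℝ) :=
  {φ | ContDiff ℝ n φ ∧ ∃ C : ℝ≥0, HolderWith C α (iteratedDeriv n φ)}

/-- `C^{n,α}_{T̄}(ℝ)`: the functions in `C^{n,α}(ℝ)` with
`φ(s) = -φ(-s) = -φ(s + T̄/2)` for all `s`. Such functions are `T̄`-periodic, so that all their
derivatives up to order `n` are automatically bounded. -/
def symHolderSpace (n : ℕ) (α : ℝ≥0) : Set (ℝ → ℝ) :=
  {φ | φ ∈ holderSpace n α ∧ ∀ s : ℝ, φ s = -φ (-s) ∧ φ s = -φ (s + period / 2)}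

/-- The `m`-th term of the explicit series for the solution, as a polynomial in `z`
(to be evaluated at `z = k(s)`). -/
def phiTerm (m : ℕ) (z : ℝ) : ℝ :=
  3 * Real.pi * Real.sqrt 2 / (64 * Real.Gamma (3 / 4) ^ 2) *
    (-(Real.Gamma (m + 3 / 4) / (2 * 4 ^ m * Real.Gamma (m + 9 / 4))) * z ^ (4 * m + 5)
      + Real.Gamma (m + 1 / 4) / (4 ^ m * Real.Gamma (m + 7 / 4)) * z ^ (4 * m + 3))

/-! The elliptic integral is a bijection of the line, so `jacobiCn` is well defined. -/

theorem integrand_pos_arg {m : ℝ} (hm0 : 0 < m) (hm1 : m < 1) (θ : ℝ) :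
    0 < 1 - m * Real.sin θ ^ 2 ∧ 1 - m * Real.sin θ ^ 2 ≤ 1 := by
  have h1 : Real.sin θ ^ 2 ≤ 1 := Real.sin_sq_le_one θ
  have h0 : 0 ≤ Real.sin θ ^ 2 := sq_nonneg _
  constructor <;> nlinarith

theorem integrand_continuous {m : ℝ} (hm0 : 0 < m) (hm1 : m < 1) :
    Continuous (fun θ : ℝ => 1 / Real.sqrt (1 - m * Real.sin θ ^ 2)) := by
  refine Continuous.div continuous_const (by fun_prop) fun θ => ?_
  exact (Real.sqrt_pos.2 (integrand_pos_arg hm0 hm1 θ).1).ne'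

theorem one_le_integrand {m : ℝ} (hm0 : 0 < m) (hm1 : m < 1) (θ : ℝ) :
    1 ≤ 1 / Real.sqrt (1 - m * Real.sin θ ^ 2) := by
  obtain ⟨h0, h1⟩ := integrand_pos_arg hm0 hm1 θ
  rw [one_le_div (Real.sqrt_pos.2 h0)]
  exact Real.sqrt_le_one.2 h1

theorem sub_le_ellipticF_sub {m : ℝ} (hm0 : 0 < m) (hm1 : m < 1) {a b : ℝ} (hab : a ≤ b) :
    b - a ≤ ellipticF b m - ellipticF a m := by
  have hc := integrand_continuous hm0 hm1
  have h : ellipticF b m - ellipticF a m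
      = ∫ θ in a..b, 1 / Real.sqrt (1 - m * Real.sin θ ^ 2) :=
    intervalIntegral.integral_interval_sub_left (hc.intervalIntegrable _ _)
      (hc.intervalIntegrable _ _)
  rw [h]
  have h2 := intervalIntegral.integral_mono_on (μ := MeasureTheory.volume) hab
    (continuous_const.intervalIntegrable a b : IntervalIntegrable (fun _ : ℝ => (1 : ℝ)) _ a b)
    (hc.intervalIntegrable a b) (fun θ _ => one_le_integrand hm0 hm1 θ)
  simpa using h2

theorem ellipticF_bijective {m : ℝ} (hm0 : 0 < m) (hm1 : m < 1) :
    Function.Bijective (fun φ : ℝ => ellipticF φ m) := by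
  have hmono : StrictMono (fun φ : ℝ => ellipticF φ m) := fun a b hab => by
    have := sub_le_ellipticF_sub hm0 hm1 hab.le
    show ellipticF a m < ellipticF b m
    linarith
  have hcont : Continuous (fun φ : ℝ => ellipticF φ m) :=
    intervalIntegral.continuous_primitive
      (fun _ _ => (integrand_continuous hm0 hm1).intervalIntegrable _ _) 0
  have h0 : ellipticF 0 m = 0 := by simp [ellipticF]
  refine ⟨hmono.injective, hcont.surjective ?_ ?_⟩
  · refine Filter.tendsto_atTop_mono' _ ?_ Filter.tendsto_id
    filter_upwards [Filter.eventually_ge_atTop 0] with x hx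
    have := sub_le_ellipticF_sub hm0 hm1 hx
    simp only [id]
    linarith
  · refine Filter.tendsto_atBot_mono' _ ?_ Filter.tendsto_id
    filter_upwards [Filter.eventually_le_atBot 0] with x hx
    have := sub_le_ellipticF_sub hm0 hm1 hx
    simp only [id]
    linarith

theorem jacobiCn_ellipticF {m : ℝ} (hm0 : 0 < m) (hm1 : m < 1) (φ : ℝ) :
    jacobiCn (ellipticF φ m) m = Real.cos φ := by
  unfold jacobiCn jacobiAm
  rw [Function.leftInverse_invFun (ellipticF_bijective hm0 hm1).injective φ]

end

end WillmoreCurve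

namespace WillmoreCurve

noncomputable section

/-! ### The amplitude function -/

/-! Write `E` for the abscissa `∫₀ˢ k²/2`. The relations `k'² = 1 - k⁴/4`, `k'' = -k³/2` and `E' =
k²/2` reduce every differential identity to algebra in `k`, `k'`, `E`.

Existence: `3/4 (s k' - k)` solves the equation and is odd, but is not antiperiodic. Dilations
contribute the kernel element `E k' - k³/2`, also odd. Since `s` and `E` both grow by a constant
over a half period, one multiple of it restores antiperiodicity. The resulting closed form
`solution` is smooth, and its derivative has a factor `k²`, which gives (ii).

Uniqueness (`eq_zero_of_isKernelJet`): translations, rotations and dilations give four kernel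
elements. The operator is self-adjoint, so the bilinear concomitant of two kernel elements is
constant. Pairing an odd antiperiodic kernel element with these four forces its 3-jet at `0`, and
then the element itself, to vanish.

Series (`hasSum_of_recursion`): `k - s k'` and `k³/2 - E k'` both satisfy `w' k' + w k³/2 = c kⁿ`.
Inserting a power series in `k` yields a hypergeometric recursion. The quotient of period and width
comes from two Beta integrals (`period_div_abscissa`) and fixes the constants. Log-convexity of
Gamma makes each term of the series times `k` nonnegative, which is (i). -/

theorem hasDerivAt_ellipticF {m : ℝ} (hm0 : 0 < m) (hm1 : m < 1) (φ : ℝ) :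
    HasDerivAt (fun φ => ellipticF φ m) (1 / Real.sqrt (1 - m * Real.sin φ ^ 2)) φ :=
  (integrand_continuous hm0 hm1).integral_hasStrictDerivAt 0 φ |>.hasDerivAt

theorem ellipticF_strictMono {m : ℝ} (hm0 : 0 < m) (hm1 : m < 1) :
    StrictMono (fun φ => ellipticF φ m) := fun a b hab => by
  have := sub_le_ellipticF_sub hm0 hm1 hab.le
  show ellipticF a m < ellipticF b m
  linarith

theorem ellipticF_neg (φ m : ℝ) : ellipticF (-φ) m = -ellipticF φ m := by
  unfold ellipticF
  rw [intervalIntegral.integral_symm]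
  have := intervalIntegral.integral_comp_neg (a := 0) (b := φ)
    (fun θ => 1 / Real.sqrt (1 - m * Real.sin θ ^ 2))
  simp only [Real.sin_neg, neg_sq, neg_zero] at this
  rw [this]

theorem ellipticF_add_pi {m : ℝ} (hm0 : 0 < m) (hm1 : m < 1) (φ : ℝ) :
    ellipticF (φ + Real.pi) m = ellipticF φ m + 2 * ellipticF (Real.pi / 2) m := by
  have hconst : ∀ x y : ℝ, ellipticF (x + Real.pi) m - ellipticF x m
      = ellipticF (y + Real.pi) m - ellipticF y m := by
    have hd : ∀ x : ℝ, HasDerivAt (fun x => ellipticF (x + Real.pi) m - ellipticF x m) 0 x := by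
      intro x
      have h1 := (hasDerivAt_ellipticF hm0 hm1 (x + Real.pi)).comp_add_const x Real.pi
      have h2 := h1.sub (hasDerivAt_ellipticF hm0 hm1 x)
      exact h2.congr_deriv (by simp [Real.sin_add_pi])
    exact is_const_of_deriv_eq_zero (fun x => (hd x).differentiableAt) fun x => (hd x).deriv
  -- At `-π/2` oddness evaluates the constant as twice the complete integral.
  have h := hconst φ (-(Real.pi / 2))
  rw [show -(Real.pi / 2) + Real.pi = Real.pi / 2 by ring, ellipticF_neg] at h
  linarith

theorem ellipticF_jacobiAm {m : ℝ} (hm0 : 0 < m) (hm1 : m < 1) (u : ℝ) :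
    ellipticF (jacobiAm u m) m = u :=
  Function.rightInverse_invFun (ellipticF_bijective hm0 hm1).surjective u

theorem jacobiAm_ellipticF {m : ℝ} (hm0 : 0 < m) (hm1 : m < 1) (φ : ℝ) :
    jacobiAm (ellipticF φ m) m = φ :=
  Function.leftInverse_invFun (ellipticF_bijective hm0 hm1).injective φ

theorem jacobiAm_strictMono {m : ℝ} (hm0 : 0 < m) (hm1 : m < 1) :
    StrictMono (fun u => jacobiAm u m) := fun a b hab => by
  refine (ellipticF_strictMono hm0 hm1).lt_iff_lt.1 ?_
  simpa only [ellipticF_jacobiAm hm0 hm1] using hab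

theorem jacobiAm_continuous {m : ℝ} (hm0 : 0 < m) (hm1 : m < 1) :
    Continuous (fun u => jacobiAm u m) :=
  (jacobiAm_strictMono hm0 hm1).monotone.continuous_of_surjective
    fun φ => ⟨_, jacobiAm_ellipticF hm0 hm1 φ⟩

theorem hasDerivAt_jacobiAm {m : ℝ} (hm0 : 0 < m) (hm1 : m < 1) (u : ℝ) :
    HasDerivAt (fun u => jacobiAm u m) (Real.sqrt (1 - m * Real.sin (jacobiAm u m) ^ 2)) u := by
  have hpos := Real.sqrt_pos.2 (integrand_pos_arg hm0 hm1 (jacobiAm u m)).1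
  have h := HasDerivAt.of_local_left_inverse (jacobiAm_continuous hm0 hm1).continuousAt
    (hasDerivAt_ellipticF hm0 hm1 (jacobiAm u m)) (one_div_pos.2 hpos).ne'
    (Filter.Eventually.of_forall (ellipticF_jacobiAm hm0 hm1))
  simpa using h

theorem jacobiAm_neg {m : ℝ} (hm0 : 0 < m) (hm1 : m < 1) (u : ℝ) :
    jacobiAm (-u) m = -jacobiAm u m := by
  apply (ellipticF_bijective hm0 hm1).injective
  simp only [ellipticF_neg, ellipticF_jacobiAm hm0 hm1]

theorem jacobiAm_add_half_period (u : ℝ) :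
    jacobiAm (u + period / 2) (1 / 2) = jacobiAm u (1 / 2) + Real.pi := by
  apply (ellipticF_bijective (m := 1 / 2) (by norm_num) (by norm_num)).injective
  simp only [ellipticF_add_pi (m := 1 / 2) (by norm_num) (by norm_num),
    ellipticF_jacobiAm (m := 1 / 2) (by norm_num) (by norm_num), period]
  ring

theorem jacobiAm_quarter_period : jacobiAm (period / 4) (1 / 2) = Real.pi / 2 := by
  rw [period, mul_div_cancel_left₀ _ (by norm_num : (4 : ℝ) ≠ 0)]
  exact jacobiAm_ellipticF (by norm_num) (by norm_num) _

theorem jacobiAm_zero : jacobiAm 0 (1 / 2) = 0 := by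
  have h := jacobiAm_ellipticF (m := 1 / 2) (by norm_num) (by norm_num) 0
  rwa [show ellipticF 0 (1 / 2) = 0 by simp [ellipticF]] at h

theorem period_pos : 0 < period := by
  have h := ellipticF_strictMono (m := 1 / 2) (by norm_num) (by norm_num)
    (by positivity : (0 : ℝ) < Real.pi / 2)
  simp only [show ellipticF 0 (1 / 2) = 0 by simp [ellipticF]] at h
  unfold period
  positivity

/-! ### The curvature function -/

theorem hasDerivAt_curvature_aux (s : ℝ) :
    HasDerivAt curvature (-(Real.sqrt 2 * Real.sin (jacobiAm (s + period / 4) (1 / 2)) *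
      Real.sqrt (1 - 1 / 2 * Real.sin (jacobiAm (s + period / 4) (1 / 2)) ^ 2))) s := by
  have h := (((hasDerivAt_jacobiAm (m := 1 / 2) (by norm_num) (by norm_num)
    (s + period / 4)).comp_add_const s (period / 4)).cos).const_mul (Real.sqrt 2)
  exact h.congr_deriv (by ring)

theorem deriv_curvature (s : ℝ) :
    deriv curvature s = -(Real.sqrt 2 * Real.sin (jacobiAm (s + period / 4) (1 / 2)) *
      Real.sqrt (1 - 1 / 2 * Real.sin (jacobiAm (s + period / 4) (1 / 2)) ^ 2)) :=
  (hasDerivAt_curvature_aux s).deriv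

theorem hasDerivAt_curvature (s : ℝ) : HasDerivAt curvature (deriv curvature s) s :=
  (hasDerivAt_curvature_aux s).differentiableAt.hasDerivAt

/-- First integral of `k'' = -k³/2`. The later differential identities are polynomial identities
modulo this relation. -/
theorem deriv_curvature_sq (s : ℝ) :
    deriv curvature s ^ 2 = 1 - curvature s ^ 4 / 4 := by
  have h2 : Real.sqrt 2 ^ 2 = 2 := Real.sq_sqrt (by norm_num)
  have hpos := (integrand_pos_arg (m := 1 / 2) (by norm_num) (by norm_num)
    (jacobiAm (s + period / 4) (1 / 2))).1
  rw [deriv_curvature, curvature, jacobiCn, neg_sq, mul_pow, mul_pow, Real.sq_sqrt hpos.le,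
    mul_pow, show Real.sqrt 2 ^ 4 = (Real.sqrt 2 ^ 2) ^ 2 by ring, h2]
  have hc := Real.sin_sq_add_cos_sq (jacobiAm (s + period / 4) (1 / 2))
  rw [show Real.cos (jacobiAm (s + period / 4) (1 / 2)) ^ 4
    = (Real.cos (jacobiAm (s + period / 4) (1 / 2)) ^ 2) ^ 2 by ring,
    show Real.cos (jacobiAm (s + period / 4) (1 / 2)) ^ 2
      = 1 - Real.sin (jacobiAm (s + period / 4) (1 / 2)) ^ 2 by linarith]
  ring

theorem hasDerivAt_deriv_curvature (s : ℝ) :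
    HasDerivAt (deriv curvature) (-(curvature s ^ 3 / 2)) s := by
  rw [show deriv curvature = _ from funext deriv_curvature]
  set a := jacobiAm (s + period / 4) (1 / 2) with ha
  have hpos := (integrand_pos_arg (m := 1 / 2) (by norm_num) (by norm_num) a).1
  have hA := (hasDerivAt_jacobiAm (m := 1 / 2) (by norm_num) (by norm_num)
    (s + period / 4)).comp_add_const s (period / 4)
  rw [← ha] at hA
  have h2 : Real.sqrt 2 ^ 2 = 2 := Real.sq_sqrt (by norm_num)
  have hD := Real.sq_sqrt hpos.le
  have hD0 := (Real.sqrt_pos.2 hpos).ne'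
  have hq : HasDerivAt (fun x => Real.sqrt (1 - 1 / 2 * Real.sin (jacobiAm (x + period / 4)
      (1 / 2)) ^ 2)) (-(Real.sin a * Real.cos a / 2)) s := by
    refine HasDerivAt.congr_deriv
      ((((hA.sin.fun_pow 2).const_mul (1 / 2)).const_sub 1).sqrt (by rw [← ha]; exact hpos.ne')) ?_
    simp only [← ha]
    revert hD0
    generalize Real.sqrt (1 - 1 / 2 * Real.sin a ^ 2) = D
    intro hD0
    field_simp
    norm_num
    ring
  refine HasDerivAt.congr_deriv ((hA.sin.const_mul (Real.sqrt 2)).fun_mul hq).fun_neg ?_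
  simp only [← ha, curvature, jacobiCn]
  have hc := Real.sin_sq_add_cos_sq a
  set D := Real.sqrt (1 - 1 / 2 * Real.sin a ^ 2)
  set r := Real.sqrt 2
  have h3 : r ^ 3 = 2 * r := by rw [pow_succ, h2]
  rw [mul_pow, h3]
  linear_combination (-r * Real.cos a) * hD + r * Real.cos a * hc

theorem curvature_add_half_period (s : ℝ) : curvature (s + period / 2) = -curvature s := by
  unfold curvature jacobiCn
  rw [add_right_comm, jacobiAm_add_half_period, Real.cos_add_pi]
  ring

theorem jacobiAm_quarter_sub (s : ℝ) :
    jacobiAm (-s + period / 4) (1 / 2) = Real.pi - jacobiAm (s + period / 4) (1 / 2) := by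
  rw [show -s + period / 4 = -(s + period / 4) + period / 2 by ring, jacobiAm_add_half_period,
    jacobiAm_neg (by norm_num) (by norm_num)]
  ring

theorem curvature_neg (s : ℝ) : curvature (-s) = -curvature s := by
  unfold curvature jacobiCn
  rw [jacobiAm_quarter_sub, Real.cos_pi_sub]
  ring

theorem deriv_curvature_neg (s : ℝ) : deriv curvature (-s) = deriv curvature s := by
  rw [deriv_curvature, deriv_curvature, jacobiAm_quarter_sub, Real.sin_pi_sub]

theorem deriv_curvature_add_half_period (s : ℝ) :
    deriv curvature (s + period / 2) = -deriv curvature s := by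
  rw [deriv_curvature, deriv_curvature, add_right_comm, jacobiAm_add_half_period, Real.sin_add_pi,
    neg_sq]
  ring

theorem curvature_zero : curvature 0 = 0 := by
  have := curvature_neg 0
  rw [neg_zero] at this
  linarith

/-- On this interval the shifted amplitude stays in `(0, π)`, where the sine is positive. -/
theorem deriv_curvature_neg_of_mem {s : ℝ} (h1 : -(period / 4) < s) (h2 : s < period / 4) :
    deriv curvature s < 0 := by
  have hm := jacobiAm_strictMono (m := 1 / 2) (by norm_num) (by norm_num)
  have ha : 0 < jacobiAm (s + period / 4) (1 / 2) := by
    have := hm (show (0 : ℝ) < s + period / 4 by linarith)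
    simpa only [jacobiAm_zero] using this
  have hb : jacobiAm (s + period / 4) (1 / 2) < Real.pi := by
    have := hm (show s + period / 4 < 0 + period / 2 by linarith)
    simp only [jacobiAm_add_half_period, jacobiAm_zero] at this
    linarith
  have hs := Real.sin_pos_of_pos_of_lt_pi ha hb
  have hD := Real.sqrt_pos.2 (integrand_pos_arg (m := 1 / 2) (by norm_num) (by norm_num)
    (jacobiAm (s + period / 4) (1 / 2))).1
  rw [deriv_curvature]
  have := Real.sqrt_pos.2 (show (0 : ℝ) < 2 by norm_num)
  have := mul_pos (mul_pos this hs) hD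
  linarith

theorem deriv_curvature_zero : deriv curvature 0 = -1 := by
  have h := deriv_curvature_sq 0
  have hp := period_pos
  have hn := deriv_curvature_neg_of_mem (s := 0) (by linarith) (by linarith)
  rw [curvature_zero] at h
  nlinarith

theorem curvature_neg_quarter_period : curvature (-(period / 4)) = Real.sqrt 2 := by
  rw [curvature, jacobiCn, neg_add_cancel, jacobiAm_zero, Real.cos_zero, mul_one]

theorem continuous_curvature : Continuous curvature :=
  continuous_iff_continuousAt.2 fun s => (hasDerivAt_curvature s).continuousAt

/-- Bootstrap on the pair `(k, k')`: the derivative of `k'` is a polynomial in `k`. -/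
theorem contDiff_curvature : ContDiff ℝ ∞ curvature := by
  have h : ∀ n : ℕ, ContDiff ℝ n curvature ∧ ContDiff ℝ n (deriv curvature) := by
    intro n
    induction n with
    | zero =>
      simp only [Nat.cast_zero, contDiff_zero]
      exact ⟨continuous_curvature,
        continuous_iff_continuousAt.2 fun s => (hasDerivAt_deriv_curvature s).continuousAt⟩
    | succ n ih =>
      simp only [Nat.cast_succ, contDiff_succ_iff_deriv]
      refine ⟨⟨fun s => (hasDerivAt_curvature s).differentiableAt, fun h => by simp at h, ih.2⟩,
        fun s => (hasDerivAt_deriv_curvature s).differentiableAt, fun h => by simp at h, ?_⟩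
      rw [show deriv (deriv curvature) = fun s => -(curvature s ^ 3 / 2) from
        funext fun s => (hasDerivAt_deriv_curvature s).deriv]
      exact ((ih.1.pow 3).div_const 2).neg
  exact contDiff_infty.2 fun n => (h n).1

theorem contDiff_deriv_curvature : ContDiff ℝ ∞ (deriv curvature) :=
  (contDiff_infty_iff_deriv.1 contDiff_curvature).2

/-! ### The abscissa of the curve -/

/-- The first coordinate `∫₀ˢ k² / 2` of the planar Willmore curve with curvature `k`. -/
def abscissa (s : ℝ) : ℝ := ∫ t in (0 : ℝ)..s, curvature t ^ 2 / 2

theorem hasDerivAt_abscissa (s : ℝ) : HasDerivAt abscissa (curvature s ^ 2 / 2) s :=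
  ((continuous_curvature.pow 2).div_const 2).integral_hasStrictDerivAt 0 s |>.hasDerivAt

theorem contDiff_abscissa : ContDiff ℝ ∞ abscissa := by
  refine contDiff_infty_iff_deriv.2 ⟨fun s => (hasDerivAt_abscissa s).differentiableAt, ?_⟩
  rw [show deriv abscissa = fun s => curvature s ^ 2 / 2 from
    funext fun s => (hasDerivAt_abscissa s).deriv]
  exact (contDiff_curvature.pow 2).div_const 2

theorem abscissa_zero : abscissa 0 = 0 := by simp [abscissa]

theorem abscissa_neg (s : ℝ) : abscissa (-s) = -abscissa s := by
  unfold abscissa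
  have := intervalIntegral.integral_comp_neg (a := 0) (b := s) (fun t => curvature t ^ 2 / 2)
  simp only [curvature_neg, neg_sq, neg_zero] at this
  rw [this, intervalIntegral.integral_symm]

theorem abscissa_add_half_period (s : ℝ) :
    abscissa (s + period / 2) = abscissa s + 2 * abscissa (period / 4) := by
  have hd : ∀ x : ℝ, HasDerivAt (fun x => abscissa (x + period / 2) - abscissa x) 0 x := by
    intro x
    have h := ((hasDerivAt_abscissa (x + period / 2)).comp_add_const x (period / 2)).sub
      (hasDerivAt_abscissa x)
    exact h.congr_deriv (by simp [curvature_add_half_period])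
  have h := is_const_of_deriv_eq_zero (fun x => (hd x).differentiableAt) (fun x => (hd x).deriv)
    s (-(period / 4))
  rw [show -(period / 4) + period / 2 = period / 4 by ring, abscissa_neg] at h
  linarith

theorem curvature_neg_of_mem {s : ℝ} (h1 : 0 < s) (h2 : s < period / 4) : curvature s < 0 := by
  have hm := jacobiAm_strictMono (m := 1 / 2) (by norm_num) (by norm_num)
  have ha := hm (show period / 4 < s + period / 4 by linarith)
  have hb := hm (show s + period / 4 < 0 + period / 2 by linarith)
  simp only [jacobiAm_quarter_period] at ha
  simp only [jacobiAm_add_half_period, jacobiAm_zero] at hb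
  have hc := Real.cos_neg_of_pi_div_two_lt_of_lt ha (by linarith [Real.pi_pos])
  exact mul_neg_of_pos_of_neg (by positivity) hc

theorem abscissa_quarter_period_pos : 0 < abscissa (period / 4) := by
  refine intervalIntegral.intervalIntegral_pos_of_pos_on
    (((continuous_curvature.pow 2).div_const 2).intervalIntegrable _ _) (fun s hs => ?_)
    (by linarith [period_pos])
  have := curvature_neg_of_mem hs.1 hs.2
  have := this.ne
  positivity

/-! ### The linearized operator on jets -/

/-- Expands the operator on an explicit chain of derivatives, so that later verifications involve
neither `deriv` of a product nor `iteratedDeriv`. -/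
theorem linWillmore_eq {f f₁ f₂ f₃ f₄ : ℝ → ℝ} (h₀ : ∀ s, HasDerivAt f (f₁ s) s)
    (h₁ : ∀ s, HasDerivAt f₁ (f₂ s) s) (h₂ : ∀ s, HasDerivAt f₂ (f₃ s) s)
    (h₃ : ∀ s, HasDerivAt f₃ (f₄ s) s) (s : ℝ) :
    linWillmore f s = f₄ s + 5 * curvature s * deriv curvature s * f₁ s
      + 5 / 2 * curvature s ^ 2 * f₂ s
      + (3 * deriv curvature s ^ 2 - 1 / 2 * curvature s ^ 4) * f s := by
  have e₀ : deriv f = f₁ := funext fun s => (h₀ s).deriv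
  have e₁ : deriv f₁ = f₂ := funext fun s => (h₁ s).deriv
  have e₂ : deriv f₂ = f₃ := funext fun s => (h₂ s).deriv
  have e₃ : deriv f₃ = f₄ := funext fun s => (h₃ s).deriv
  have e : iteratedDeriv 4 f = f₄ := by
    simp only [iteratedDeriv_succ, iteratedDeriv_zero, e₀, e₁, e₂, e₃]
  have hm : HasDerivAt (fun t => 5 / 2 * curvature t ^ 2 * f₁ t)
      (5 * curvature s * deriv curvature s * f₁ s + 5 / 2 * curvature s ^ 2 * f₂ s) s := by
    refine ((((hasDerivAt_curvature s).fun_pow 2).const_mul (5 / 2)).fun_mul (h₁ s)).congr_deriv ?_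
    simp only [Nat.cast_ofNat, Nat.add_one_sub_one, pow_one]
    ring
  rw [linWillmore, e, e₀, hm.deriv]
  ring

/-- The 3-jet `(f, f₁, f₂, f₃)` of a solution of `L̃₀ f = 0`. -/
structure IsKernelJet (f f₁ f₂ f₃ : ℝ → ℝ) : Prop where
  deriv₀ : ∀ s, HasDerivAt f (f₁ s) s
  deriv₁ : ∀ s, HasDerivAt f₁ (f₂ s) s
  deriv₂ : ∀ s, HasDerivAt f₂ (f₃ s) s
  deriv₃ : ∀ s, HasDerivAt f₃ (-(5 * curvature s * deriv curvature s * f₁ s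
      + 5 / 2 * curvature s ^ 2 * f₂ s
      + (3 * deriv curvature s ^ 2 - 1 / 2 * curvature s ^ 4) * f s)) s

/-- The bilinear concomitant of the self-adjoint operator `L̃₀`. -/
def concomitant (u u₁ u₂ u₃ w w₁ w₂ w₃ : ℝ → ℝ) (s : ℝ) : ℝ :=
  u s * w₃ s - u₁ s * w₂ s + u₂ s * w₁ s - u₃ s * w s
    + 5 / 2 * curvature s ^ 2 * (u s * w₁ s - u₁ s * w s)

theorem concomitant_eq {u u₁ u₂ u₃ w w₁ w₂ w₃ : ℝ → ℝ} (hu : IsKernelJet u u₁ u₂ u₃)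
    (hw : IsKernelJet w w₁ w₂ w₃) (s t : ℝ) :
    concomitant u u₁ u₂ u₃ w w₁ w₂ w₃ s = concomitant u u₁ u₂ u₃ w w₁ w₂ w₃ t := by
  have hd : ∀ x, HasDerivAt (concomitant u u₁ u₂ u₃ w w₁ w₂ w₃) 0 x := by
    intro x
    refine HasDerivAt.congr_deriv
      ((((((hu.deriv₀ x).fun_mul (hw.deriv₃ x)).fun_sub
        ((hu.deriv₁ x).fun_mul (hw.deriv₂ x))).fun_add
        ((hu.deriv₂ x).fun_mul (hw.deriv₁ x))).fun_sub
        ((hu.deriv₃ x).fun_mul (hw.deriv₀ x))).fun_add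
        ((((hasDerivAt_curvature x).fun_pow 2).const_mul (5 / 2)).fun_mul
          (((hu.deriv₀ x).fun_mul (hw.deriv₁ x)).fun_sub
            ((hu.deriv₁ x).fun_mul (hw.deriv₀ x))))) ?_
    norm_num
    ring
  exact is_const_of_deriv_eq_zero (fun x => (hd x).differentiableAt) (fun x => (hd x).deriv) s t

/-- The field generated by the translations in the direction of the axis. -/
theorem isKernelJet_curvature_sq : IsKernelJet (fun s => curvature s ^ 2)
    (fun s => 2 * curvature s * deriv curvature s) (fun s => 2 - 3 / 2 * curvature s ^ 4)
    (fun s => -6 * curvature s ^ 3 * deriv curvature s) := by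
  constructor <;> intro s <;> have hk := hasDerivAt_curvature s <;>
    have hp := hasDerivAt_deriv_curvature s <;> have hpk := deriv_curvature_sq s
  · exact (hk.fun_pow 2).congr_deriv (by norm_num)
  · exact ((hk.const_mul 2).fun_mul hp).congr_deriv (by linear_combination 2 * hpk)
  · exact (((hk.fun_pow 4).const_mul (3 / 2)).const_sub 2).congr_deriv (by norm_num; ring)
  · refine (((hk.fun_pow 3).const_mul (-6)).fun_mul hp).congr_deriv ?_
    norm_num
    linear_combination (-5 * curvature s ^ 2) * hpk

/-- The field generated by the translations orthogonal to the axis. -/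
theorem isKernelJet_deriv_curvature : IsKernelJet (deriv curvature)
    (fun s => -(curvature s ^ 3 / 2)) (fun s => -(3 / 2) * curvature s ^ 2 * deriv curvature s)
    (fun s => -3 * curvature s + 3 / 2 * curvature s ^ 5) := by
  constructor <;> intro s <;> have hk := hasDerivAt_curvature s <;>
    have hp := hasDerivAt_deriv_curvature s <;> have hpk := deriv_curvature_sq s
  · exact hp
  · exact ((hk.fun_pow 3).div_const 2).fun_neg.congr_deriv (by norm_num; ring)
  · refine (((hk.fun_pow 2).const_mul (-(3 / 2))).fun_mul hp).congr_deriv ?_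
    norm_num
    linear_combination (-3 * curvature s) * hpk
  · refine ((hk.const_mul (-3)).fun_add ((hk.fun_pow 5).const_mul (3 / 2))).congr_deriv ?_
    norm_num
    linear_combination (3 * deriv curvature s) * hpk

/-- The field generated by the rotations. -/
theorem isKernelJet_rotation : IsKernelJet
    (fun s => abscissa s * (curvature s ^ 2 / 2) + curvature s * deriv curvature s)
    (fun s => abscissa s * (curvature s * deriv curvature s) + (1 - curvature s ^ 4 / 2))
    (fun s => abscissa s * (1 - 3 / 4 * curvature s ^ 4)
      - 3 / 2 * curvature s ^ 3 * deriv curvature s)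
    (fun s => abscissa s * (-3 * curvature s ^ 3 * deriv curvature s)
      + (-4 * curvature s ^ 2 + 3 / 2 * curvature s ^ 6)) := by
  constructor <;> intro s <;> have hk := hasDerivAt_curvature s <;>
    have hp := hasDerivAt_deriv_curvature s <;> have hpk := deriv_curvature_sq s <;>
    have hE := hasDerivAt_abscissa s
  · refine ((hE.fun_mul ((hk.fun_pow 2).div_const 2)).fun_add (hk.fun_mul hp)).congr_deriv ?_
    norm_num
    linear_combination hpk
  · refine ((hE.fun_mul (hk.fun_mul hp)).fun_add
      (((hk.fun_pow 4).div_const 2).const_sub 1)).congr_deriv ?_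
    norm_num
    linear_combination abscissa s * hpk
  · refine ((hE.fun_mul (((hk.fun_pow 4).const_mul (3 / 4)).const_sub 1)).fun_sub
      (((hk.fun_pow 3).const_mul (3 / 2)).fun_mul hp)).congr_deriv ?_
    norm_num
    linear_combination (-9 / 2 * curvature s ^ 2) * hpk
  · refine ((hE.fun_mul (((hk.fun_pow 3).const_mul (-3)).fun_mul hp)).fun_add
      (((hk.fun_pow 2).const_mul (-4)).fun_add
        ((hk.fun_pow 6).const_mul (3 / 2)))).congr_deriv ?_
    norm_num
    linear_combination (-5 / 2 * abscissa s * curvature s ^ 2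
      + 3 * curvature s * deriv curvature s) * hpk

/-- The field generated by the dilations. -/
theorem isKernelJet_dilation : IsKernelJet
    (fun s => abscissa s * deriv curvature s - curvature s ^ 3 / 2)
    (fun s => abscissa s * (-(curvature s ^ 3 / 2)) - curvature s ^ 2 * deriv curvature s)
    (fun s => abscissa s * (-(3 / 2) * curvature s ^ 2 * deriv curvature s)
      + (-2 * curvature s + 3 / 4 * curvature s ^ 5))
    (fun s => abscissa s * (-3 * curvature s + 3 / 2 * curvature s ^ 5)
      + (3 * curvature s ^ 4 - 2) * deriv curvature s) := by
  constructor <;> intro s <;> have hk := hasDerivAt_curvature s <;>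
    have hp := hasDerivAt_deriv_curvature s <;> have hpk := deriv_curvature_sq s <;>
    have hE := hasDerivAt_abscissa s
  · refine ((hE.fun_mul hp).fun_sub ((hk.fun_pow 3).div_const 2)).congr_deriv ?_
    norm_num
    ring
  · refine ((hE.fun_mul ((hk.fun_pow 3).div_const 2).fun_neg).fun_sub
      ((hk.fun_pow 2).fun_mul hp)).congr_deriv ?_
    norm_num
    linear_combination (-2 * curvature s) * hpk
  · refine ((hE.fun_mul (((hk.fun_pow 2).const_mul (-(3 / 2))).fun_mul hp)).fun_add
      ((hk.const_mul (-2)).fun_add ((hk.fun_pow 5).const_mul (3 / 4)))).congr_deriv ?_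
    norm_num
    linear_combination (-3 * abscissa s * curvature s) * hpk
  · refine ((hE.fun_mul ((hk.const_mul (-3)).fun_add ((hk.fun_pow 5).const_mul (3 / 2)))).fun_add
      ((((hk.fun_pow 4).const_mul 3).sub_const 2).fun_mul hp)).congr_deriv ?_
    norm_num
    linear_combination (3 * abscissa s * deriv curvature s + 11 / 2 * curvature s ^ 3) * hpk

/-! ### Symmetries of jets and triviality of the symmetric kernel -/

theorem hasDerivAt_even_of_odd {f f' : ℝ → ℝ} (h : ∀ s, HasDerivAt f (f' s) s)
    (hf : ∀ s, f (-s) = -f s) (s : ℝ) : f' (-s) = f' s := by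
  have h1 := (h (-s)).comp s (hasDerivAt_neg s)
  have h2 : HasDerivAt (f ∘ fun s => -s) (-f' s) s :=
    (h s).fun_neg.congr_of_eventuallyEq (Filter.Eventually.of_forall hf)
  linarith [h1.unique h2]

theorem hasDerivAt_odd_of_even {f f' : ℝ → ℝ} (h : ∀ s, HasDerivAt f (f' s) s)
    (hf : ∀ s, f (-s) = f s) (s : ℝ) : f' (-s) = -f' s := by
  have h1 := (h (-s)).comp s (hasDerivAt_neg s)
  have h2 : HasDerivAt (f ∘ fun s => -s) (f' s) s :=
    (h s).congr_of_eventuallyEq (Filter.Eventually.of_forall hf)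
  linarith [h1.unique h2]

theorem hasDerivAt_antiperiodic {f f' : ℝ → ℝ} {c : ℝ} (h : ∀ s, HasDerivAt f (f' s) s)
    (hf : ∀ s, f (s + c) = -f s) (s : ℝ) : f' (s + c) = -f' s := by
  have h1 := (h (s + c)).comp_add_const s c
  have h2 : HasDerivAt (fun s => f (s + c)) (-f' s) s :=
    (h s).fun_neg.congr_of_eventuallyEq (Filter.Eventually.of_forall hf)
  exact h1.unique h2

/-- The kernel of `L̃₀` is trivial on odd functions which are antiperiodic of antiperiod `T̄/2`. -/
theorem eq_zero_of_isKernelJet {w w₁ w₂ w₃ : ℝ → ℝ} (hw : IsKernelJet w w₁ w₂ w₃)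
    (hodd : ∀ s, w (-s) = -w s) (hanti : ∀ s, w (s + period / 2) = -w s) (s : ℝ) : w s = 0 := by
  have o₁ := hasDerivAt_even_of_odd hw.deriv₀ hodd
  have o₂ := hasDerivAt_odd_of_even hw.deriv₁ o₁
  have a₁ := hasDerivAt_antiperiodic hw.deriv₀ hanti
  have a₂ := hasDerivAt_antiperiodic hw.deriv₁ a₁
  have a₃ := hasDerivAt_antiperiodic hw.deriv₂ a₂
  have w0 : w 0 = 0 := by have := hodd 0; rw [neg_zero] at this; linarith
  have w20 : w₂ 0 = 0 := by have := o₂ 0; rw [neg_zero] at this; linarith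
  have wT := hanti 0
  have w1T := a₁ 0
  have w2T := a₂ 0
  have w3T := a₃ 0
  have kT := curvature_add_half_period 0
  have pT := deriv_curvature_add_half_period 0
  have ET := abscissa_add_half_period 0
  rw [zero_add] at wT w1T w2T w3T kT pT ET
  rw [curvature_zero, neg_zero] at kT
  rw [deriv_curvature_zero, neg_neg] at pT
  rw [abscissa_zero, zero_add] at ET
  have hP := abscissa_quarter_period_pos
  have c1 := concomitant_eq isKernelJet_curvature_sq hw
  have c2 := concomitant_eq isKernelJet_deriv_curvature hw
  have c3 := concomitant_eq isKernelJet_rotation hw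
  have c4 := concomitant_eq isKernelJet_dilation hw
  simp only [concomitant] at c1 c2 c3 c4
  -- The concomitant with `k²` equals `2 w₁` at both `0` and `T̄/2`, while antiperiodicity flips the
  -- sign of `w₁`.
  have w10 : w₁ 0 = 0 := by
    have := c1 0 (period / 2)
    simp only [kT, pT, wT, w1T, w2T, w3T, curvature_zero, w0, w20] at this
    linarith
  -- The concomitant with the dilation field vanishes at `0`, but at `T̄/2` it is `-2 E(T̄/4)
  -- w₃(0)`, because `E` is not periodic.
  have w30 : w₃ 0 = 0 := by
    have := c4 0 (period / 2)
    simp only [kT, pT, ET, wT, w1T, w2T, w3T, curvature_zero, deriv_curvature_zero, abscissa_zero,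
      w0, w20, w10] at this
    have h : abscissa (period / 4) * w₃ 0 = 0 := by linarith
    exact (mul_eq_zero.1 h).resolve_left hP.ne'
  have c1 := c1 s 0
  have c2 := c2 s 0
  have c3 := c3 s 0
  have c4 := c4 s 0
  simp only [w0, w10, w20, w30, mul_zero, sub_zero, add_zero] at c1 c2 c3 c4
  have hpk := deriv_curvature_sq s
  generalize curvature s = k at *
  generalize deriv curvature s = p at *
  generalize abscissa s = E at *
  generalize w s = x at *
  generalize w₁ s = x₁ at *
  generalize w₂ s = x₂ at *
  generalize w₃ s = x₃ at *
  -- The kernel elements pair off as (`k²`, rotation) and (`k'`, dilation). Weighting each equation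
  -- by the value of its partner, with alternating signs, cancels `w₁`, `w₂`, `w₃` modulo the first
  -- integral and leaves a nonzero multiple of `w`.
  linear_combination (1 / 2) * (-k ^ 2 * c3 + (E * (k ^ 2 / 2) + k * p) * c1
    - (E * p - k ^ 3 / 2) * c2 + p * c4) + (k ^ 2 * x₂ / 2 - x * (1 + k ^ 4 / 4)) * hpk

/-! ### Hölder continuity of smooth periodic functions -/

theorem exists_holderWith_of_periodic {f : ℝ → ℝ} {c : ℝ} (hf : ContDiff ℝ 1 f)
    (hper : Function.Periodic f c) (hc : c ≠ 0) {α : ℝ≥0} (hα1 : α ≤ 1) :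
    ∃ C : ℝ≥0, HolderWith C α f := by
  have hd : Continuous (deriv f) := hf.continuous_deriv_one
  have hdper : Function.Periodic (deriv f) c := fun x => by
    rw [← deriv_comp_add_const, show (fun x => f (x + c)) = f from funext hper]
  obtain ⟨M, hM⟩ := isBounded_iff_forall_norm_le.1 (hper.isBounded_of_continuous hc hf.continuous)
  obtain ⟨K, hK⟩ := isBounded_iff_forall_norm_le.1 (hdper.isBounded_of_continuous hc hd)
  have hM' : ∀ x, |f x| ≤ M := fun x => hM _ ⟨x, rfl⟩
  have hK' : ∀ x, ‖deriv f x‖₊ ≤ K.toNNReal := fun x =>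
    NNReal.le_toNNReal_of_coe_le (hK _ ⟨x, rfl⟩)
  have hL := lipschitzWith_of_nnnorm_deriv_le (hf.differentiable one_ne_zero) hK'
  -- The Lipschitz constant serves at distance at most `1`, twice the sup bound at larger distance.
  refine ⟨max K.toNNReal (2 * M).toNNReal, fun x y => ?_⟩
  rw [edist_nndist, edist_nndist, ← ENNReal.coe_rpow_of_nonneg _ α.coe_nonneg, ← ENNReal.coe_mul,
    ENNReal.coe_le_coe]
  rcases le_total (nndist x y) 1 with h | h
  · refine (hL.nndist_le x y).trans (mul_le_mul' (le_max_left _ _) ?_)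
    rcases eq_or_ne (nndist x y) 0 with h0 | h0
    · rw [h0]; exact zero_le
    · calc nndist x y = nndist x y ^ (1 : ℝ) := (NNReal.rpow_one _).symm
        _ ≤ nndist x y ^ (α : ℝ) :=
          NNReal.rpow_le_rpow_of_exponent_ge (pos_iff_ne_zero.2 h0) h (by exact_mod_cast hα1)
  · have h1 : nndist (f x) (f y) ≤ (2 * M).toNNReal := by
      apply NNReal.le_toNNReal_of_coe_le
      rw [coe_nndist, Real.dist_eq]
      have := abs_sub (f x) (f y)
      linarith [hM' x, hM' y]
    calc nndist (f x) (f y) ≤ max K.toNNReal (2 * M).toNNReal * 1 := by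
          rw [mul_one]; exact h1.trans (le_max_right _ _)
      _ ≤ _ := mul_le_mul' le_rfl (NNReal.one_le_rpow h α.coe_nonneg)

theorem iteratedDeriv_periodic {f : ℝ → ℝ} {c : ℝ} (hper : Function.Periodic f c) (n : ℕ) :
    Function.Periodic (iteratedDeriv n f) c := fun x => by
  have h := congrFun (iteratedDeriv_comp_add_const n f c) x
  rwa [show (fun x => f (x + c)) = f from funext hper, eq_comm] at h

/-! ### The solution in closed form -/

/-- The coefficient of the dilation field that makes the solution antiperiodic. -/
def dilationCoeff : ℝ := -(3 * period / (16 * abscissa (period / 4)))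

/-- The solution of `L̃₀ φ = ḡ`. -/
def solution (s : ℝ) : ℝ :=
  3 / 4 * (s * deriv curvature s - curvature s)
    + dilationCoeff * (abscissa s * deriv curvature s - curvature s ^ 3 / 2)

theorem dilationCoeff_mul : dilationCoeff * abscissa (period / 4) = -(3 * period / 16) := by
  have := abscissa_quarter_period_pos.ne'
  unfold dilationCoeff
  field_simp

theorem solution_neg (s : ℝ) : solution (-s) = -solution s := by
  simp only [solution, curvature_neg, deriv_curvature_neg, abscissa_neg]
  ring

theorem solution_add_half_period (s : ℝ) : solution (s + period / 2) = -solution s := by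
  simp only [solution, curvature_add_half_period, deriv_curvature_add_half_period,
    abscissa_add_half_period]
  linear_combination (-2 * deriv curvature s) * dilationCoeff_mul

theorem contDiff_solution : ContDiff ℝ ∞ solution :=
  (contDiff_const.mul ((contDiff_id.mul contDiff_deriv_curvature).sub contDiff_curvature)).add
    (contDiff_const.mul ((contDiff_abscissa.mul contDiff_deriv_curvature).sub
      ((contDiff_curvature.pow 3).div_const 2)))

theorem hasDerivAt_solution (s : ℝ) : HasDerivAt solution
    (-((3 / 4 * s + dilationCoeff * abscissa s) * (curvature s ^ 3 / 2))
      - dilationCoeff * (curvature s ^ 2 * deriv curvature s)) s := by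
  have hk := hasDerivAt_curvature s
  refine (((((hasDerivAt_id s).fun_mul (hasDerivAt_deriv_curvature s)).fun_sub hk).const_mul
    (3 / 4)).fun_add ((isKernelJet_dilation.deriv₀ s).const_mul dilationCoeff)).congr_deriv ?_
  simp only [id]
  ring

theorem linWillmore_solution (s : ℝ) : linWillmore solution s = gBar s := by
  have hW : ∀ s, HasDerivAt (fun s => 3 / 4 * s + dilationCoeff * abscissa s)
      (3 / 4 + dilationCoeff * (curvature s ^ 2 / 2)) s := fun s =>
    (((hasDerivAt_id s).const_mul (3 / 4)).fun_add
      ((hasDerivAt_abscissa s).const_mul dilationCoeff)).congr_deriv (by simp)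
  have h₁ : ∀ s, HasDerivAt (fun s => -((3 / 4 * s + dilationCoeff * abscissa s)
      * (curvature s ^ 3 / 2)) - dilationCoeff * (curvature s ^ 2 * deriv curvature s))
      (-(3 / 8) * curvature s ^ 3 - 2 * dilationCoeff * curvature s
        + 3 / 4 * dilationCoeff * curvature s ^ 5
        - (3 / 4 * s + dilationCoeff * abscissa s)
          * (3 / 2 * curvature s ^ 2 * deriv curvature s)) s := fun s => by
    have hk := hasDerivAt_curvature s
    refine ((((hW s).fun_mul ((hk.fun_pow 3).div_const 2)).fun_neg).fun_sub
      (((hk.fun_pow 2).fun_mul (hasDerivAt_deriv_curvature s)).const_mul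
        dilationCoeff)).congr_deriv ?_
    norm_num
    linear_combination (-2 * dilationCoeff * curvature s) * deriv_curvature_sq s
  have h₂ : ∀ s, HasDerivAt (fun s => -(3 / 8) * curvature s ^ 3 - 2 * dilationCoeff * curvature s
        + 3 / 4 * dilationCoeff * curvature s ^ 5
        - (3 / 4 * s + dilationCoeff * abscissa s)
          * (3 / 2 * curvature s ^ 2 * deriv curvature s))
      (-(9 / 4) * curvature s ^ 2 * deriv curvature s - 2 * dilationCoeff * deriv curvature s
        + 3 * dilationCoeff * curvature s ^ 4 * deriv curvature s
        - (3 / 4 * s + dilationCoeff * abscissa s)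
          * (3 * curvature s - 3 / 2 * curvature s ^ 5)) s := fun s => by
    have hk := hasDerivAt_curvature s
    refine (((((hk.fun_pow 3).const_mul (-(3 / 8))).fun_sub
      (hk.const_mul (2 * dilationCoeff))).fun_add
      ((hk.fun_pow 5).const_mul (3 / 4 * dilationCoeff))).fun_sub
      ((hW s).fun_mul (((hk.fun_pow 2).const_mul (3 / 2)).fun_mul
        (hasDerivAt_deriv_curvature s)))).congr_deriv ?_
    norm_num
    linear_combination (-3 * (3 / 4 * s + dilationCoeff * abscissa s) * curvature s)
      * deriv_curvature_sq s
  have h₃ : ∀ s, HasDerivAt (fun s => -(9 / 4) * curvature s ^ 2 * deriv curvature s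
        - 2 * dilationCoeff * deriv curvature s
        + 3 * dilationCoeff * curvature s ^ 4 * deriv curvature s
        - (3 / 4 * s + dilationCoeff * abscissa s)
          * (3 * curvature s - 3 / 2 * curvature s ^ 5))
      (-(9 / 2) * curvature s * deriv curvature s ^ 2 + 9 / 8 * curvature s ^ 5
        + dilationCoeff * curvature s ^ 3
        + 12 * dilationCoeff * curvature s ^ 3 * deriv curvature s ^ 2
        - 3 / 2 * dilationCoeff * curvature s ^ 7
        - (3 / 4 + dilationCoeff * (curvature s ^ 2 / 2))
          * (3 * curvature s - 3 / 2 * curvature s ^ 5)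
        - (3 / 4 * s + dilationCoeff * abscissa s)
          * (3 - 15 / 2 * curvature s ^ 4) * deriv curvature s) s := fun s => by
    have hk := hasDerivAt_curvature s
    have hp := hasDerivAt_deriv_curvature s
    refine ((((((hk.fun_pow 2).const_mul (-(9 / 4))).fun_mul hp).fun_sub
      (hp.const_mul (2 * dilationCoeff))).fun_add
      (((hk.fun_pow 4).const_mul (3 * dilationCoeff)).fun_mul hp)).fun_sub
      ((hW s).fun_mul ((hk.const_mul 3).fun_sub ((hk.fun_pow 5).const_mul (3 / 2))))).congr_deriv ?_
    norm_num
    ring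
  rw [linWillmore_eq hasDerivAt_solution h₁ h₂ h₃, gBar, solution]
  have hpk := deriv_curvature_sq s
  generalize curvature s = k at *
  generalize deriv curvature s = p at *
  generalize abscissa s = E at *
  -- The equation holds for every coefficient `d`, as it multiplies a kernel element; only
  -- antiperiodicity selects its value.
  generalize dilationCoeff = d at *
  linear_combination (9 / 4 * k + 11 / 2 * k ^ 3 * d + 3 * p * d * E + 9 / 4 * p * s) * hpk

theorem solution_mem_symHolderSpace {α : ℝ≥0} (hα1 : α ≤ 1) : solution ∈ symHolderSpace 4 α := by
  refine ⟨⟨contDiff_infty.1 contDiff_solution 4, ?_⟩, fun s => ⟨?_, ?_⟩⟩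
  · have hper : Function.Periodic solution period := fun s => by
      rw [show s + period = s + period / 2 + period / 2 by ring, solution_add_half_period,
        solution_add_half_period, neg_neg]
    refine exists_holderWith_of_periodic ?_ (iteratedDeriv_periodic hper 4) period_pos.ne' hα1
    rw [iteratedDeriv_eq_iterate]
    exact (contDiff_infty.1 contDiff_solution 5).iterate_deriv' 1 4
  · rw [solution_neg, neg_neg]
  · rw [solution_add_half_period, neg_neg]

theorem deriv_solution_of_curvature_eq_zero {s : ℝ} (h : curvature s = 0) :
    deriv solution s = 0 := by
  rw [(hasDerivAt_solution s).deriv, h]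
  ring

/-- By linearity the difference of the two functions is an odd antiperiodic kernel element. -/
theorem eq_of_linWillmore_eq {α : ℝ≥0} {φ ψ : ℝ → ℝ} (hφ : φ ∈ symHolderSpace 4 α)
    (hψ : ψ ∈ symHolderSpace 4 α) (h : ∀ s, linWillmore ψ s = linWillmore φ s) : ψ = φ := by
  have hd : ∀ {f : ℝ → ℝ}, f ∈ symHolderSpace 4 α → ∀ n < 4, ∀ s,
      HasDerivAt (iteratedDeriv n f) (iteratedDeriv (n + 1) f s) s := fun hf n hn s => by
    rw [iteratedDeriv_succ]
    exact ((hf.1.1.differentiable_iteratedDeriv n (by exact_mod_cast hn)) s).hasDerivAt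
  have hL : ∀ {f : ℝ → ℝ}, f ∈ symHolderSpace 4 α → ∀ s, linWillmore f s = _ := fun hf =>
    linWillmore_eq (hd hf 0 (by norm_num)) (hd hf 1 (by norm_num)) (hd hf 2 (by norm_num))
      (hd hf 3 (by norm_num))
  have hjet : IsKernelJet (fun s => ψ s - φ s)
      (fun s => iteratedDeriv 1 ψ s - iteratedDeriv 1 φ s)
      (fun s => iteratedDeriv 2 ψ s - iteratedDeriv 2 φ s)
      (fun s => iteratedDeriv 3 ψ s - iteratedDeriv 3 φ s) := by
    refine ⟨fun s => (hd hψ 0 (by norm_num) s).fun_sub (hd hφ 0 (by norm_num) s),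
      fun s => (hd hψ 1 (by norm_num) s).fun_sub (hd hφ 1 (by norm_num) s),
      fun s => (hd hψ 2 (by norm_num) s).fun_sub (hd hφ 2 (by norm_num) s), fun s => ?_⟩
    refine ((hd hψ 3 (by norm_num) s).fun_sub (hd hφ 3 (by norm_num) s)).congr_deriv ?_
    have := h s
    rw [hL hψ, hL hφ] at this
    norm_num at this ⊢
    linear_combination this
  funext s
  refine sub_eq_zero.1 (eq_zero_of_isKernelJet hjet (fun s => ?_) (fun s => ?_) s)
  · linarith [(hψ.2 s).1, (hφ.2 s).1]
  · linarith [(hψ.2 s).2, (hφ.2 s).2]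

/-! ### Power series in the curvature -/

theorem curvature_le (s : ℝ) : curvature s ≤ Real.sqrt 2 :=
  mul_le_of_le_one_right (Real.sqrt_nonneg _) (Real.cos_le_one _)

theorem curvature_nonneg_of_mem {s : ℝ} (h1 : -(period / 4) ≤ s) (h2 : s ≤ 0) :
    0 ≤ curvature s := by
  rcases h1.eq_or_lt with rfl | h1
  · rw [curvature_neg_quarter_period]
    positivity
  rcases h2.eq_or_lt with rfl | h2
  · rw [curvature_zero]
  have h := curvature_neg_of_mem (s := -s) (by linarith) (by linarith)
  rw [curvature_neg] at h
  linarith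

/-- A hypergeometric recursion for coefficients gives geometric decay. -/
theorem coeff_bound {a : ℕ → ℝ} {j : ℕ} (ha : ∀ m, 0 ≤ a m)
    (hrec : ∀ m : ℕ, (4 * m + j + 4) * a (m + 1) = (4 * m + j - 2) / 4 * a m) (N : ℕ) :
    (4 * N + j) * a N ≤ j * a 0 / 4 ^ N := by
  induction N with
  | zero => simp
  | succ N ih =>
    have h := hrec N
    have : (4 * ((N + 1 : ℕ) : ℝ) + j) * a (N + 1) ≤ (4 * N + j) * a N / 4 := by
      push_cast
      linarith [ha N]
    refine this.trans ?_
    rw [pow_succ, ← div_div]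
    linarith

/-- By the first integral, `w ↦ w' k' + w k³/2` sends `kⁿ` to `n kⁿ⁻¹ - (n - 2)/4 · kⁿ⁺³`. The
recursion makes the sum telescope, leaving the first and the last term. -/
theorem partialSum_deriv {a : ℕ → ℝ} {j : ℕ} (hj : 2 ≤ j)
    (hrec : ∀ m : ℕ, (4 * m + j + 4) * a (m + 1) = (4 * m + j - 2) / 4 * a m) (N : ℕ) (s : ℝ) :
    ∃ S' : ℝ, HasDerivAt (fun s => ∑ m ∈ Finset.range N, a m * curvature s ^ (4 * m + j)) S' s ∧
      S' * deriv curvature s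
          + (∑ m ∈ Finset.range N, a m * curvature s ^ (4 * m + j)) * (curvature s ^ 3 / 2)
        = j * a 0 * curvature s ^ (j - 1) - (4 * N + j) * a N * curvature s ^ (4 * N + j - 1) := by
  obtain ⟨i, rfl⟩ : ∃ i, j = i + 1 := ⟨j - 1, by omega⟩
  induction N with
  | zero => exact ⟨0, by simpa using hasDerivAt_const s (0 : ℝ), by simp⟩
  | succ N ih =>
    obtain ⟨S', hS, hS'⟩ := ih
    simp only [Finset.sum_range_succ]
    refine ⟨_, hS.fun_add (((hasDerivAt_curvature s).fun_pow (4 * N + (i + 1))).const_mul (a N)), ?_⟩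
    have hr := hrec N
    have hpk := deriv_curvature_sq s
    simp only [← add_assoc, Nat.add_sub_cancel] at hS' hr ⊢
    rw [show 4 * (N + 1) + i = 4 * N + i + 4 by ring, pow_succ _ (4 * N + i),
      pow_add _ (4 * N + i)]
    push_cast at hr hS' ⊢
    linear_combination hS' + a N * (4 * N + i + 1) * curvature s ^ (4 * N + i) * hpk
      + curvature s ^ (4 * N + i) * curvature s ^ 4 * hr

/-- The left side of `hode` is `k'² (w/k')'`. Hence the remainder divided by `k'` has an explicit
derivative of size `O(ρ^N)`, and it vanishes at `0`. The endpoint `-T̄/4` is excluded because `k'`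
vanishes there. -/
theorem tendsto_partialSum {a : ℕ → ℝ} {j : ℕ} (hj : 2 ≤ j) (ha : ∀ m, 0 ≤ a m)
    (hrec : ∀ m : ℕ, (4 * m + j + 4) * a (m + 1) = (4 * m + j - 2) / 4 * a m)
    {w w' : ℝ → ℝ} (hw0 : w 0 = 0) (hw : ∀ s, HasDerivAt w (w' s) s)
    (hode : ∀ s, w' s * deriv curvature s + w s * (curvature s ^ 3 / 2)
      = j * a 0 * curvature s ^ (j - 1)) {s : ℝ} (hs1 : -(period / 4) < s) (hs2 : s ≤ 0) :
    Filter.Tendsto (fun N => ∑ m ∈ Finset.range N, a m * curvature s ^ (4 * m + j))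
      Filter.atTop (nhds (w s)) := by
  have hp : ∀ t ∈ Set.Icc s 0, deriv curvature t ≠ 0 := fun t ht =>
    (deriv_curvature_neg_of_mem (hs1.trans_le ht.1)
      (ht.2.trans_lt (by linarith [period_pos]))).ne
  have hcp : Continuous (deriv curvature) :=
    continuous_iff_continuousAt.2 fun t => (hasDerivAt_deriv_curvature t).continuousAt
  obtain ⟨t₀, ht₀, hmax⟩ := isCompact_Icc.exists_isMaxOn (Set.nonempty_Icc.2 hs2)
    (f := fun t => curvature t ^ 4 / 4) (by have := continuous_curvature; fun_prop)
  -- `M` bounds the derivative of the remainder for `N = 0`; each further term costs a factor at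
  -- most `k⁴/4 ≤ ρ < 1`.
  obtain ⟨M, hM⟩ := isCompact_Icc.exists_bound_of_continuousOn (s := Set.Icc s 0)
    (f := fun t => j * a 0 * curvature t ^ (j - 1) / deriv curvature t ^ 2)
    (ContinuousOn.div (by have := continuous_curvature; fun_prop) (by fun_prop)
      fun t ht => pow_ne_zero 2 (hp t ht))
  set ρ := curvature t₀ ^ 4 / 4 with hρ
  have hρ0 : 0 ≤ ρ := by positivity
  have hρ1 : ρ < 1 := by
    have h1 := deriv_curvature_sq t₀
    have h2 := pow_pos (abs_pos.2 (hp t₀ ht₀)) 2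
    rw [sq_abs] at h2
    linarith
  have key : ∀ N, |(w s - ∑ m ∈ Finset.range N, a m * curvature s ^ (4 * m + j))
      / deriv curvature s| ≤ M * ρ ^ N * |s| := by
    intro N
    set D : ℝ → ℝ := fun s => w s - ∑ m ∈ Finset.range N, a m * curvature s ^ (4 * m + j) with hD
    have hderiv : ∀ t ∈ Set.Icc s 0, HasDerivAt (fun t => D t / deriv curvature t)
        ((4 * N + j) * a N * curvature t ^ (4 * N + j - 1) / deriv curvature t ^ 2) t := by
      intro t ht
      obtain ⟨S', hS, hS'⟩ := partialSum_deriv hj hrec N t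
      refine (((hw t).fun_sub hS).fun_div (hasDerivAt_deriv_curvature t) (hp t ht)).congr_deriv ?_
      congr 1
      linear_combination hode t - hS'
    have hbound : ∀ t ∈ Set.Icc s 0,
        ‖(4 * N + j) * a N * curvature t ^ (4 * N + j - 1) / deriv curvature t ^ 2‖
          ≤ M * ρ ^ N := by
      intro t ht
      have hk : 0 ≤ curvature t := curvature_nonneg_of_mem (hs1.le.trans ht.1) ht.2
      have h1 := coeff_bound ha hrec N
      have h2 := hM t ht
      have h3 : curvature t ^ 4 / 4 ≤ ρ := hmax ht
      have h4 : 0 < deriv curvature t ^ 2 := by have := hp t ht; positivity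
      have ha0 := ha 0
      have haN := ha N
      rw [Real.norm_of_nonneg (by positivity)] at h2 ⊢
      calc (4 * N + j) * a N * curvature t ^ (4 * N + j - 1) / deriv curvature t ^ 2
          ≤ (j * a 0 / 4 ^ N) * curvature t ^ (4 * N + j - 1) / deriv curvature t ^ 2 := by gcongr
        _ = (j * a 0 * curvature t ^ (j - 1) / deriv curvature t ^ 2)
            * (curvature t ^ 4 / 4) ^ N := by
          rw [show 4 * N + j - 1 = 4 * N + (j - 1) by omega, pow_add, pow_mul, div_pow]
          ring
        _ ≤ M * ρ ^ N := by gcongr; exact (by positivity : (0:ℝ) ≤ _).trans h2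
    have hmv := (convex_Icc s 0).norm_image_sub_le_of_norm_hasDerivWithin_le
      (fun t ht => (hderiv t ht).hasDerivWithinAt) hbound (Set.right_mem_Icc.2 hs2)
      (Set.left_mem_Icc.2 hs2)
    have hD0 : D 0 = 0 := by
      simp only [hD, hw0, curvature_zero]
      rw [Finset.sum_eq_zero fun m _ => by rw [zero_pow (by omega), mul_zero], sub_zero]
    simpa only [hD0, zero_div, sub_zero, Real.norm_eq_abs] using hmv
  have h0 : Filter.Tendsto (fun N => (w s - ∑ m ∈ Finset.range N, a m * curvature s ^ (4 * m + j))
      / deriv curvature s) Filter.atTop (nhds 0) := by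
    refine squeeze_zero_norm key ?_
    simpa using ((tendsto_pow_atTop_nhds_zero_of_lt_one hρ0 hρ1).const_mul M).mul_const |s|
  have h1 := (h0.mul_const (deriv curvature s)).const_sub (w s)
  simpa [div_mul_cancel₀ _ (hp s (Set.left_mem_Icc.2 hs2))] using h1

theorem hasSum_of_recursion {a : ℕ → ℝ} {j : ℕ} (hj : 2 ≤ j) (ha : ∀ m, 0 ≤ a m)
    (hrec : ∀ m : ℕ, (4 * m + j + 4) * a (m + 1) = (4 * m + j - 2) / 4 * a m)
    {w w' : ℝ → ℝ} (hw0 : w 0 = 0) (hw : ∀ s, HasDerivAt w (w' s) s)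
    (hode : ∀ s, w' s * deriv curvature s + w s * (curvature s ^ 3 / 2)
      = j * a 0 * curvature s ^ (j - 1)) {s : ℝ} (hs1 : -(period / 4) ≤ s) (hs2 : s ≤ 0) :
    HasSum (fun m => a m * curvature s ^ (4 * m + j)) (w s) := by
  have hint : ∀ t, -(period / 4) < t → t ≤ 0 →
      HasSum (fun m => a m * curvature t ^ (4 * m + j)) (w t) := fun t h1 h2 => by
    refine (hasSum_iff_tendsto_nat_of_nonneg (fun m => ?_) _).2
      (tendsto_partialSum hj ha hrec hw0 hw hode h1 h2)
    exact mul_nonneg (ha m) (pow_nonneg (curvature_nonneg_of_mem h1.le h2) _)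
  rcases hs1.lt_or_eq with hs1 | rfl
  · exact hint s hs1 hs2
  have hT := period_pos
  have hev : ∀ᶠ t in nhdsWithin (-(period / 4)) (Set.Ioi (-(period / 4))),
      -(period / 4) < t ∧ t ≤ 0 := by
    filter_upwards [Ioc_mem_nhdsGT (show -(period / 4) < 0 by linarith)] with t ht
    exact ht
  have hwt : Filter.Tendsto w (nhdsWithin (-(period / 4)) (Set.Ioi (-(period / 4))))
      (nhds (w (-(period / 4)))) := (hw _).continuousAt.continuousWithinAt
  have hnn : ∀ m, 0 ≤ a m * curvature (-(period / 4)) ^ (4 * m + j) := fun m =>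
    mul_nonneg (ha m) (pow_nonneg (curvature_nonneg_of_mem le_rfl hs2) _)
  -- At the endpoint the terms are nonnegative. Partial sums are bounded by `w` through continuity,
  -- and the reverse inequality follows by termwise comparison, since `k` attains its maximum `√2`
  -- there.
  have hle : ∀ N, ∑ m ∈ Finset.range N, a m * curvature (-(period / 4)) ^ (4 * m + j)
      ≤ w (-(period / 4)) := fun N => by
    have hc : Continuous fun t => ∑ m ∈ Finset.range N, a m * curvature t ^ (4 * m + j) := by
      have := continuous_curvature
      fun_prop
    refine le_of_tendsto_of_tendsto hc.continuousAt.continuousWithinAt hwt ?_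
    filter_upwards [hev] with t ht
    exact sum_le_hasSum _ (fun m _ => mul_nonneg (ha m)
      (pow_nonneg (curvature_nonneg_of_mem ht.1.le ht.2) _)) (hint t ht.1 ht.2)
  have hsum := summable_of_sum_range_le hnn hle
  have h1 := Real.tsum_le_of_sum_range_le hnn hle
  have h2 : w (-(period / 4)) ≤ ∑' m, a m * curvature (-(period / 4)) ^ (4 * m + j) := by
    refine le_of_tendsto hwt ?_
    filter_upwards [hev] with t ht
    refine hasSum_le (fun m => ?_) (hint t ht.1 ht.2) hsum.hasSum
    rw [curvature_neg_quarter_period]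
    exact mul_le_mul_of_nonneg_left (pow_le_pow_left₀ (curvature_nonneg_of_mem ht.1.le ht.2)
      (curvature_le t) _) (ha m)
  rw [← le_antisymm h1 h2]
  exact hsum.hasSum

/-! ### The quarter period and the quarter width as Beta integrals -/

theorem beta_half_eq_integral (u : ℝ) (hu : 0 < u) :
    ProbabilityTheory.beta u (1 / 2)
      = ∫ t in Set.Ioo (0 : ℝ) 1, t ^ (u - 1) * (1 - t) ^ (-(1 / 2) : ℝ) := by
  rw [ProbabilityTheory.beta_eq_betaIntegralReal u (1 / 2) hu (by norm_num), Complex.betaIntegral,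
    intervalIntegral.integral_of_le zero_le_one, MeasureTheory.integral_Ioc_eq_integral_Ioo,
    ← Complex.ofReal_re (∫ t in Set.Ioo (0 : ℝ) 1, t ^ (u - 1) * (1 - t) ^ (-(1 / 2) : ℝ)),
    ← integral_complex_ofReal]
  congr 1
  refine MeasureTheory.setIntegral_congr_fun measurableSet_Ioo fun t ht => ?_
  rw [Complex.ofReal_mul, Complex.ofReal_cpow ht.1.le, Complex.ofReal_cpow (by linarith [ht.2])]
  push_cast
  norm_num

theorem curvature_pos_of_mem {s : ℝ} (h1 : -(period / 4) < s) (h2 : s < 0) : 0 < curvature s := by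
  have h := curvature_neg_of_mem (s := -s) (by linarith) (by linarith)
  rw [curvature_neg] at h
  linarith

theorem hasDerivAt_curvature_pow_four_div (s : ℝ) : HasDerivAt (fun s => curvature s ^ 4 / 4)
    (curvature s ^ 3 * deriv curvature s) s :=
  (((hasDerivAt_curvature s).fun_pow 4).div_const 4).congr_deriv (by norm_num; ring)

theorem strictAntiOn_curvature_pow_four_div :
    StrictAntiOn (fun s => curvature s ^ 4 / 4) (Set.Icc (-(period / 4)) 0) := by
  refine strictAntiOn_of_deriv_neg (convex_Icc _ _)
    ((continuous_curvature.pow 4).div_const 4).continuousOn fun s hs => ?_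
  rw [interior_Icc] at hs
  rw [(hasDerivAt_curvature_pow_four_div s).deriv]
  exact mul_neg_of_pos_of_neg (pow_pos (curvature_pos_of_mem hs.1 hs.2) 3)
    (deriv_curvature_neg_of_mem hs.1 (hs.2.trans (by linarith [period_pos])))

theorem image_curvature_pow_four_div :
    (fun s => curvature s ^ 4 / 4) '' Set.Ioo (-(period / 4)) 0 = Set.Ioo 0 1 := by
  have hT := period_pos
  have e1 : curvature (-(period / 4)) ^ 4 / 4 = 1 := by
    rw [curvature_neg_quarter_period, show Real.sqrt 2 ^ 4 = (Real.sqrt 2 ^ 2) ^ 2 by ring,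
      Real.sq_sqrt (by norm_num)]
    norm_num
  have e0 : curvature 0 ^ 4 / 4 = 0 := by rw [curvature_zero]; norm_num
  have hle : -(period / 4) ≤ 0 := by linarith
  refine Set.Subset.antisymm ?_ ?_
  · rintro _ ⟨s, hs, rfl⟩
    have h1 := strictAntiOn_curvature_pow_four_div (Set.left_mem_Icc.2 hle)
      (Set.Ioo_subset_Icc_self hs) hs.1
    have h2 := strictAntiOn_curvature_pow_four_div (Set.Ioo_subset_Icc_self hs)
      (Set.right_mem_Icc.2 hle) hs.2
    simp only [e0, e1] at h1 h2
    exact ⟨h2, h1⟩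
  · have h := intermediate_value_Ioo' hle
      (f := fun s => curvature s ^ 4 / 4) ((continuous_curvature.pow 4).div_const 4).continuousOn
    simpa only [e0, e1] using h

/-- Substitution `t = k⁴/4`: here `1 - t = k'²`, so `(1 - t)^(-1/2)` cancels the factor `|k'|` of
the Jacobian `k³ |k'|`. -/
theorem beta_half_eq_integral_curvature (u : ℝ) (hu : 0 < u) :
    ProbabilityTheory.beta u (1 / 2)
      = ∫ s in Set.Ioo (-(period / 4)) 0, curvature s ^ 3 * (curvature s ^ 4 / 4) ^ (u - 1) := by
  rw [beta_half_eq_integral u hu, ← image_curvature_pow_four_div,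
    MeasureTheory.integral_image_eq_integral_abs_deriv_smul measurableSet_Ioo
      (fun s _ => (hasDerivAt_curvature_pow_four_div s).hasDerivWithinAt)
      (strictAntiOn_curvature_pow_four_div.injOn.mono Set.Ioo_subset_Icc_self)]
  refine MeasureTheory.setIntegral_congr_fun measurableSet_Ioo fun s hs => ?_
  have hk := curvature_pos_of_mem hs.1 hs.2
  have hp := deriv_curvature_neg_of_mem hs.1 (hs.2.trans (by linarith [period_pos]))
  simp only [smul_eq_mul]
  rw [← deriv_curvature_sq, ← sq_abs (deriv curvature s), abs_mul, abs_of_pos (pow_pos hk 3),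
    Real.rpow_neg (sq_nonneg _), ← Real.sqrt_eq_rpow, Real.sqrt_sq (abs_nonneg _)]
  have := (abs_pos.2 hp.ne).ne'
  field_simp

theorem curvature_pow_rpow {k : ℝ} (hk : 0 < k) :
    k ^ 3 * (k ^ 4 / 4) ^ ((1 / 4 : ℝ) - 1) = 2 * Real.sqrt 2 ∧
      k ^ 3 * (k ^ 4 / 4) ^ ((3 / 4 : ℝ) - 1) = 2 * Real.sqrt 2 * (k ^ 2 / 2) := by
  have h2 : Real.sqrt 2 ^ 2 = 2 := Real.sq_sqrt (by norm_num)
  have hs : 0 < Real.sqrt 2 := by positivity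
  -- As a fourth power, it turns the exponents `-3/4` and `-1/4` into the integers `-3` and `-1`.
  have h4 : k ^ 4 / 4 = (k / Real.sqrt 2) ^ (4 : ℝ) := by
    rw [Real.rpow_ofNat, div_pow, show Real.sqrt 2 ^ 4 = (Real.sqrt 2 ^ 2) ^ 2 by ring, h2]
    norm_num
  rw [h4, ← Real.rpow_mul (by positivity), ← Real.rpow_mul (by positivity),
    show (4 : ℝ) * (1 / 4 - 1) = -(3 : ℕ) by norm_num,
    show (4 : ℝ) * (3 / 4 - 1) = -(1 : ℕ) by norm_num, Real.rpow_neg (by positivity),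
    Real.rpow_neg (by positivity), Real.rpow_natCast, Real.rpow_natCast]
  constructor
  · field_simp
    linear_combination h2
  · field_simp

theorem beta_one_quarter : ProbabilityTheory.beta (1 / 4) (1 / 2)
    = Real.sqrt 2 / 2 * period := by
  rw [beta_half_eq_integral_curvature _ (by norm_num), MeasureTheory.setIntegral_congr_fun
    (g := fun _ => 2 * Real.sqrt 2) measurableSet_Ioo fun s hs =>
      (curvature_pow_rpow (curvature_pos_of_mem hs.1 hs.2)).1,
    ← MeasureTheory.integral_Ioc_eq_integral_Ioo,
    ← intervalIntegral.integral_of_le (by linarith [period_pos])]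
  simp
  ring

theorem beta_three_quarters : ProbabilityTheory.beta (3 / 4) (1 / 2)
    = 2 * Real.sqrt 2 * abscissa (period / 4) := by
  rw [beta_half_eq_integral_curvature _ (by norm_num), MeasureTheory.setIntegral_congr_fun
    (g := fun s => 2 * Real.sqrt 2 * (curvature s ^ 2 / 2)) measurableSet_Ioo fun s hs =>
      (curvature_pow_rpow (curvature_pos_of_mem hs.1 hs.2)).2,
    ← MeasureTheory.integral_Ioc_eq_integral_Ioo,
    ← intervalIntegral.integral_of_le (by linarith [period_pos]),
    intervalIntegral.integral_const_mul, intervalIntegral.integral_symm]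
  have := abscissa_neg (period / 4)
  rw [abscissa] at this
  rw [this, neg_neg]

/-! ### Gamma values -/

theorem Gamma_one_quarter_mul : Real.Gamma (1 / 4) * Real.Gamma (3 / 4)
    = Real.pi * Real.sqrt 2 := by
  have h := Real.Gamma_mul_Gamma_one_sub (1 / 4)
  rw [show (1 : ℝ) - 1 / 4 = 3 / 4 by norm_num, show Real.pi * (1 / 4) = Real.pi / 4 by ring,
    Real.sin_pi_div_four] at h
  rw [h]
  have h2 : Real.sqrt 2 ^ 2 = 2 := Real.sq_sqrt (by norm_num)
  field_simp
  linear_combination -h2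

theorem period_div_abscissa : period / abscissa (period / 4)
    = Real.Gamma (1 / 4) ^ 2 / Real.Gamma (3 / 4) ^ 2 := by
  have h1 := beta_one_quarter
  have h2 := beta_three_quarters
  have hg1 : Real.Gamma (1 / 4) ≠ 0 := (Real.Gamma_pos_of_pos (by norm_num)).ne'
  have hg3 : Real.Gamma (3 / 4) ≠ 0 := (Real.Gamma_pos_of_pos (by norm_num)).ne'
  have hg2 : Real.Gamma (1 / 2) ≠ 0 := (Real.Gamma_pos_of_pos (by norm_num)).ne'
  have hs : Real.sqrt 2 ≠ 0 := by positivity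
  have ha := abscissa_quarter_period_pos.ne'
  have e : Real.Gamma (3 / 4 + 1 / 2) = 1 / 4 * Real.Gamma (1 / 4) := by
    rw [← Real.Gamma_add_one (by norm_num)]
    norm_num
  rw [ProbabilityTheory.beta, e] at h2
  rw [ProbabilityTheory.beta, show (1 / 4 + 1 / 2 : ℝ) = 3 / 4 by norm_num] at h1
  have h : period = 2 / Real.sqrt 2 * (Real.Gamma (1 / 4) * Real.Gamma (1 / 2)
      / Real.Gamma (3 / 4)) := by
    rw [h1]
    field_simp
  have h' : abscissa (period / 4) = 1 / (2 * Real.sqrt 2) * (Real.Gamma (3 / 4) *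
      Real.Gamma (1 / 2) / (1 / 4 * Real.Gamma (1 / 4))) := by
    rw [h2]
    field_simp
  rw [h', h]
  field_simp
  norm_num

/-- The ratio `Γ(m + p) / (4ᵐ Γ(m + q))`. -/
def gammaRatio (p q : ℝ) (m : ℕ) : ℝ := Real.Gamma (m + p) / (4 ^ m * Real.Gamma (m + q))

theorem gammaRatio_pos {p q : ℝ} (hp : 0 < p) (hq : 0 < q) (m : ℕ) : 0 < gammaRatio p q m :=
  div_pos (Real.Gamma_pos_of_pos (by positivity))
    (mul_pos (by positivity) (Real.Gamma_pos_of_pos (by positivity)))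

theorem gammaRatio_succ {p q : ℝ} (hp : 0 < p) (hq : 0 < q) (m : ℕ) :
    (4 * m + 4 * q) * gammaRatio p q (m + 1) = (4 * m + 4 * p) / 4 * gammaRatio p q m := by
  have hq' : (m : ℝ) + q ≠ 0 := by positivity
  have hp' : (m : ℝ) + p ≠ 0 := by positivity
  have hg : Real.Gamma (m + q) ≠ 0 := (Real.Gamma_pos_of_pos (by positivity)).ne'
  unfold gammaRatio
  push_cast
  rw [show (m : ℝ) + 1 + p = m + p + 1 by ring, show (m : ℝ) + 1 + q = m + q + 1 by ring,
    Real.Gamma_add_one hp', Real.Gamma_add_one hq', pow_succ]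
  field_simp

/-- Log-convexity of Gamma: `x + 1/2` and `x + 3/2` divide `[x, x + 2]` with weights `3/4, 1/4` and
`1/4, 3/4`. Taking `x = m + 1/4` compares the two coefficients of `phiTerm`. -/
theorem Gamma_add_half_mul_le {x : ℝ} (hx : 0 < x) :
    Real.Gamma (x + 1 / 2) * Real.Gamma (x + 3 / 2) ≤ Real.Gamma x * Real.Gamma (x + 2) := by
  have h1 := Real.Gamma_mul_add_mul_le_rpow_Gamma_mul_rpow_Gamma hx (show 0 < x + 2 by linarith)
    (show (0 : ℝ) < 3 / 4 by norm_num) (show (0 : ℝ) < 1 / 4 by norm_num) (by norm_num)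
  have h2 := Real.Gamma_mul_add_mul_le_rpow_Gamma_mul_rpow_Gamma hx (show 0 < x + 2 by linarith)
    (show (0 : ℝ) < 1 / 4 by norm_num) (show (0 : ℝ) < 3 / 4 by norm_num) (by norm_num)
  rw [show 3 / 4 * x + 1 / 4 * (x + 2) = x + 1 / 2 by ring] at h1
  rw [show 1 / 4 * x + 3 / 4 * (x + 2) = x + 3 / 2 by ring] at h2
  have g0 := Real.Gamma_pos_of_pos hx
  have g2 := Real.Gamma_pos_of_pos (show 0 < x + 2 by linarith)
  have g3 := Real.Gamma_pos_of_pos (show 0 < x + 3 / 2 by linarith)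
  refine (mul_le_mul h1 h2 g3.le (by positivity)).trans_eq ?_
  rw [mul_mul_mul_comm, ← Real.rpow_add g0, mul_comm (Real.Gamma (x + 2) ^ (1 / 4 : ℝ)),
    ← Real.rpow_add g2]
  norm_num

theorem gammaRatio_le (m : ℕ) : gammaRatio (3 / 4) (9 / 4) m ≤ gammaRatio (1 / 4) (7 / 4) m := by
  have h := Gamma_add_half_mul_le (x := m + 1 / 4) (by positivity)
  rw [show (m : ℝ) + 1 / 4 + 1 / 2 = m + 3 / 4 by ring,
    show (m : ℝ) + 1 / 4 + 3 / 2 = m + 7 / 4 by ring,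
    show (m : ℝ) + 1 / 4 + 2 = m + 9 / 4 by ring] at h
  unfold gammaRatio
  have g1 := Real.Gamma_pos_of_pos (show (0 : ℝ) < m + 9 / 4 by positivity)
  have g2 := Real.Gamma_pos_of_pos (show (0 : ℝ) < m + 7 / 4 by positivity)
  rw [div_le_div_iff₀ (by positivity) (by positivity)]
  have := mul_le_mul_of_nonneg_left h (by positivity : (0 : ℝ) ≤ 4 ^ m)
  linarith

theorem phiTerm_eq (m : ℕ) (z : ℝ) : phiTerm m z
    = 3 * Real.pi * Real.sqrt 2 / (64 * Real.Gamma (3 / 4) ^ 2) *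
      (-(1 / 2 * gammaRatio (3 / 4) (9 / 4) m * z ^ (4 * m + 5))
        + gammaRatio (1 / 4) (7 / 4) m * z ^ (4 * m + 3)) := by
  have : Real.Gamma (m + 3 / 4) / (2 * 4 ^ m * Real.Gamma (m + 9 / 4))
      = 1 / 2 * gammaRatio (3 / 4) (9 / 4) m := by
    rw [gammaRatio, mul_assoc, ← div_div, ← mul_div_assoc, div_mul_eq_mul_div, one_mul]
  rw [phiTerm, this, neg_mul]
  rfl

theorem phiTerm_mul_nonneg (m : ℕ) {z : ℝ} (hz : z ^ 2 ≤ 2) : 0 ≤ phiTerm m z * z := by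
  have h1 := gammaRatio_le m
  have h0 := (gammaRatio_pos (p := 3 / 4) (q := 9 / 4) (by norm_num) (by norm_num) m).le
  have h : 0 ≤ gammaRatio (1 / 4) (7 / 4) m - gammaRatio (3 / 4) (9 / 4) m * (z ^ 2 / 2) := by
    have := mul_le_mul_of_nonneg_left (show z ^ 2 / 2 ≤ 1 by linarith) h0
    linarith
  have e : phiTerm m z * z = 3 * Real.pi * Real.sqrt 2 / (64 * Real.Gamma (3 / 4) ^ 2) *
      ((z ^ 2) ^ (2 * m + 2) *
        (gammaRatio (1 / 4) (7 / 4) m - gammaRatio (3 / 4) (9 / 4) m * (z ^ 2 / 2))) := by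
    rw [phiTerm_eq]
    ring
  rw [e]
  have := Real.Gamma_pos_of_pos (show (0 : ℝ) < 3 / 4 by norm_num)
  positivity

theorem phiTerm_neg (m : ℕ) (z : ℝ) : phiTerm m (-z) = -phiTerm m z := by
  rw [phiTerm_eq, phiTerm_eq, Odd.neg_pow ⟨2 * m + 2, by ring⟩, Odd.neg_pow ⟨2 * m + 1, by ring⟩]
  ring

/-! ### The series of the solution -/

theorem hasSum_translation_part {s : ℝ} (hs1 : -(period / 4) ≤ s) (hs2 : s ≤ 0) :
    HasSum (fun m : ℕ => Real.Gamma (9 / 4) / (10 * Real.Gamma (3 / 4))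
        * gammaRatio (3 / 4) (9 / 4) m * curvature s ^ (4 * m + 5))
      (curvature s - s * deriv curvature s) := by
  have g1 := Real.Gamma_pos_of_pos (show (0 : ℝ) < 9 / 4 by norm_num)
  have g2 := Real.Gamma_pos_of_pos (show (0 : ℝ) < 3 / 4 by norm_num)
  refine hasSum_of_recursion (w := fun s => curvature s - s * deriv curvature s)
    (w' := fun s => s * (curvature s ^ 3 / 2)) (by norm_num)
    (fun m => mul_nonneg (by positivity)
      (gammaRatio_pos (by norm_num) (by norm_num) m).le) (fun m => ?_) ?_ (fun s => ?_)
    (fun s => ?_) hs1 hs2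
  · have h := gammaRatio_succ (p := 3 / 4) (q := 9 / 4) (by norm_num) (by norm_num) m
    push_cast
    linear_combination Real.Gamma (9 / 4) / (10 * Real.Gamma (3 / 4)) * h
  · simp [curvature_zero]
  · refine ((hasDerivAt_curvature s).fun_sub
      ((hasDerivAt_id s).fun_mul (hasDerivAt_deriv_curvature s))).congr_deriv ?_
    simp
  -- The prefactor normalizes `a 0 = 1/10`, so that `5 · a 0 · k⁴` is the right side `k⁴/2`.
  · have : Real.Gamma (9 / 4) / (10 * Real.Gamma (3 / 4)) * gammaRatio (3 / 4) (9 / 4) 0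
        = 1 / 10 := by
      simp only [gammaRatio, Nat.cast_zero, zero_add, pow_zero, one_mul]
      field_simp
    rw [this]
    norm_num
    ring

theorem hasSum_dilation_part {s : ℝ} (hs1 : -(period / 4) ≤ s) (hs2 : s ≤ 0) :
    HasSum (fun m : ℕ => Real.Gamma (7 / 4) / (3 * Real.Gamma (1 / 4))
        * gammaRatio (1 / 4) (7 / 4) m * curvature s ^ (4 * m + 3))
      (curvature s ^ 3 / 2 - abscissa s * deriv curvature s) := by
  have g1 := Real.Gamma_pos_of_pos (show (0 : ℝ) < 7 / 4 by norm_num)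
  have g2 := Real.Gamma_pos_of_pos (show (0 : ℝ) < 1 / 4 by norm_num)
  refine hasSum_of_recursion (w := fun s => curvature s ^ 3 / 2 - abscissa s * deriv curvature s)
    (w' := fun s => abscissa s * (curvature s ^ 3 / 2) + curvature s ^ 2 * deriv curvature s)
    (by norm_num)
    (fun m => mul_nonneg (by positivity)
      (gammaRatio_pos (by norm_num) (by norm_num) m).le) (fun m => ?_) ?_ (fun s => ?_)
    (fun s => ?_) hs1 hs2
  · have h := gammaRatio_succ (p := 1 / 4) (q := 7 / 4) (by norm_num) (by norm_num) m
    push_cast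
    linear_combination Real.Gamma (7 / 4) / (3 * Real.Gamma (1 / 4)) * h
  · simp [curvature_zero, abscissa_zero]
  · have h := (isKernelJet_dilation.deriv₀ s).fun_neg
    simp only [neg_sub] at h
    exact h.congr_deriv (by ring)
  -- Here `a 0 = 1/3`, since the right side is `k²` and `j = 3`.
  · have : Real.Gamma (7 / 4) / (3 * Real.Gamma (1 / 4)) * gammaRatio (1 / 4) (7 / 4) 0
        = 1 / 3 := by
      simp only [gammaRatio, Nat.cast_zero, zero_add, pow_zero, one_mul]
      field_simp
    rw [this]
    norm_num
    linear_combination curvature s ^ 2 * deriv_curvature_sq s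

theorem translation_coeff : 3 / 4 * (Real.Gamma (9 / 4) / (10 * Real.Gamma (3 / 4)))
    = 3 * Real.pi * Real.sqrt 2 / (64 * Real.Gamma (3 / 4) ^ 2) * (1 / 2) := by
  have g3 := (Real.Gamma_pos_of_pos (show (0 : ℝ) < 3 / 4 by norm_num)).ne'
  have e : Real.Gamma (9 / 4) = 5 / 16 * Real.Gamma (1 / 4) := by
    rw [show (9 / 4 : ℝ) = 5 / 4 + 1 by norm_num, Real.Gamma_add_one (by norm_num),
      show (5 / 4 : ℝ) = 1 / 4 + 1 by norm_num, Real.Gamma_add_one (by norm_num)]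
    ring
  rw [mul_assoc 3, ← Gamma_one_quarter_mul, e]
  field_simp
  norm_num

theorem dilation_coeff : -dilationCoeff * (Real.Gamma (7 / 4) / (3 * Real.Gamma (1 / 4)))
    = 3 * Real.pi * Real.sqrt 2 / (64 * Real.Gamma (3 / 4) ^ 2) := by
  have g1 := (Real.Gamma_pos_of_pos (show (0 : ℝ) < 1 / 4 by norm_num)).ne'
  have g3 := (Real.Gamma_pos_of_pos (show (0 : ℝ) < 3 / 4 by norm_num)).ne'
  have e : Real.Gamma (7 / 4) = 3 / 4 * Real.Gamma (3 / 4) := by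
    rw [show (7 / 4 : ℝ) = 3 / 4 + 1 by norm_num, Real.Gamma_add_one (by norm_num)]
  have d : -dilationCoeff = 3 / 16 * (period / abscissa (period / 4)) := by
    unfold dilationCoeff
    rw [neg_neg, mul_div_mul_comm]
  rw [mul_assoc 3, ← Gamma_one_quarter_mul, e, d, period_div_abscissa]
  field_simp
  norm_num

theorem hasSum_solution (s : ℝ) : HasSum (fun m => phiTerm m (curvature s)) (solution s) := by
  have hmain : ∀ s, -(period / 4) ≤ s → s ≤ 0 →
      HasSum (fun m => phiTerm m (curvature s)) (solution s) := by
    intro s h1 h2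
    have h := ((hasSum_translation_part h1 h2).mul_left (-(3 / 4))).add
      ((hasSum_dilation_part h1 h2).mul_left (-dilationCoeff))
    have e : solution s = -(3 / 4) * (curvature s - s * deriv curvature s)
        + -dilationCoeff * (curvature s ^ 3 / 2 - abscissa s * deriv curvature s) := by
      unfold solution
      ring
    rw [e]
    refine (congrArg (fun f => HasSum f _) (funext fun m => ?_)).mpr h
    rw [phiTerm_eq]
    linear_combination (gammaRatio (3 / 4) (9 / 4) m * curvature s ^ (4 * m + 5))
      * translation_coeff - gammaRatio (1 / 4) (7 / 4) m * curvature s ^ (4 * m + 3)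
      * dilation_coeff
  have hneg : ∀ s, HasSum (fun m => phiTerm m (-curvature s)) (-solution s) ↔
      HasSum (fun m => phiTerm m (curvature s)) (solution s) := fun s => by
    simp only [phiTerm_neg]
    exact ⟨fun h => by simpa only [neg_neg] using h.neg, HasSum.neg⟩
  -- The statement itself is treated as a `T̄/2`-periodic predicate of `s`. It can then be checked
  -- on `(-T̄/4, T̄/4]`, and by oddness on `[-T̄/4, 0]`.
  have hper : Function.Periodic
      (fun s => HasSum (fun m => phiTerm m (curvature s)) (solution s)) (period / 2) := fun s => by
    simp only [curvature_add_half_period, solution_add_half_period, hneg]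
  obtain ⟨t, ht, hst⟩ := hper.exists_mem_Ioc (by linarith [period_pos]) s (-(period / 4))
  refine (iff_of_eq hst).2 ?_
  rcases le_total t 0 with h | h
  · exact hmain t ht.1.le h
  · have := hmain (-t) (by linarith [ht.2]) (by linarith)
    rwa [curvature_neg, solution_neg, hneg] at this

/-! ### Sign of the solution and conclusion -/

theorem curvature_sq_le (s : ℝ) : curvature s ^ 2 ≤ 2 := by
  have h := deriv_curvature_sq s
  nlinarith [sq_nonneg (deriv curvature s), sq_nonneg (curvature s)]

theorem solution_mul_curvature_nonneg (s : ℝ) : 0 ≤ solution s * curvature s :=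
  ((hasSum_solution s).mul_right (curvature s)).nonneg fun m =>
    phiTerm_mul_nonneg m (curvature_sq_le s)

end

end WillmoreCurve

theorem proposition2p2 (α : ℝ≥0) (hα0 : 0 < α) (hα1 : α < 1) :
    ∃ φ : ℝ → ℝ,
      φ ∈ WillmoreCurve.symHolderSpace 4 α ∧
      (∀ s : ℝ, WillmoreCurve.linWillmore φ s = WillmoreCurve.gBar s) ∧
      (∀ ψ : ℝ → ℝ, ψ ∈ WillmoreCurve.symHolderSpace 4 α →
        (∀ s : ℝ, WillmoreCurve.linWillmore ψ s = WillmoreCurve.gBar s) → ψ = φ) ∧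
      ContDiff ℝ ∞ φ ∧
      (∀ s : ℝ, HasSum (fun m : ℕ => WillmoreCurve.phiTerm m (WillmoreCurve.curvature s)) (φ s)) ∧
      (∀ s : ℝ, 0 ≤ φ s * WillmoreCurve.curvature s) ∧
      (∀ s : ℝ, WillmoreCurve.curvature s = 0 → deriv φ s = 0) := by
  have hmem := WillmoreCurve.solution_mem_symHolderSpace hα1.le
  refine ⟨WillmoreCurve.solution, hmem, WillmoreCurve.linWillmore_solution, fun ψ hψ h =>
    WillmoreCurve.eq_of_linWillmore_eq hmem hψ fun s => ?_, WillmoreCurve.contDiff_solution,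
    WillmoreCurve.hasSum_solution, WillmoreCurve.solution_mul_curvature_nonneg,
    fun s hs => WillmoreCurve.deriv_solution_of_curvature_eq_zero hs⟩
  rw [h s, WillmoreCurve.linWillmore_solution s]
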